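/- Let $\mathcal{X}$ be a non-empty set, let $\mathcal{L}$ be the real vector space of all gambles (bounded real-valued maps) on $\mathcal{X}$, and identify each real number with the corresponding constant gamble. Let $\mathcal{Q}$ be the set of all finite subsets of $\mathcal{L}$, including $\emptyset$. For $V\subseteq\mathcal{L}$ let $\mathrm{posi}(V)$ be the set of all sums $\sum_{k=1}^n\lambda_k u_k$ with $n\ge 1$, $\lambda_k>0$ and $u_k\in V$; write $(\lambda,\mu)>0$ if $\lambda\ge0$, $\mu\ge0$ and $\lambda+\mu>0$; and write $A-v=\{u-v: u\in A\}$. A set $D\subseteq\mathcal{L}$ is *coherent* if $0\notin D$, if $D$ contains every gamble $u$ with $\inf u>0$, and if $\lambda u+\mu v\in D$ whenever $u,v\in D$ and $(\lambda,\mu)>0$. It is *mixing* if it is coherent and, for all $A\in\mathcal{Q}$, $\mathrm{posi}(A)\cap D\ne\emptyset$ implies $A\cap D\neq\emptyset$. It is *Archimedean* if it is coherent and for every $u\in D$ there is a real $\epsilon>0$ with $u-\epsilon\in D$. For Archimedean $D$ let $\underline{P}_D(u)=\sup\{\mu\in\mathbb{R}: u-\mu\in D\}$ for $u\in\mathcal{L}$.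 A set $\mathcal{D}$ of Archimedean sets $D$ is *closed* if it contains every Archimedean $D$ for which $\underline{P}_D$ lies in the closure of $\{\underline{P}_{D'}:D'\in\mathcal{D}\}$ in $\mathbb{R}^{\mathcal{L}}$ with the topology of pointwise convergence. Let $K_D=\{A\in\mathcal{Q}: A\cap D\ne\emptyset\}$. A set $K\subseteq\mathcal{Q}$ is *coherent* if, for all $A,A_1,A_2\in\mathcal{Q}$: $A\in K$ implies $A\setminus\{0\}\in K$; $\{0\}\notin K$; $\{u\}\in K$ for every gamble $u$ with $\inf u>0$; if $A_1,A_2\in K$ and $(\lambda_{u,v},\mu_{u,v})>0$ for all $u\in A_1$ and $v\in A_2$, then $\{\lambda_{u,v}u+\mu_{u,v}v: u\in A_1,\,v\in A_2\}\in K$; and $A_1\in K$ and $A_1\subseteq A_2$ imply $A_2\in K$. It is *mixing* if it is coherent and $B\in K$, $A\subseteq B\subseteq\mathrm{posi}(A)$ imply $A\in K$ for all $A,B\in\mathcal{Q}$. It is *Archimedean* if it is coherent and for every $A\in K$ there is a real $\epsilon>0$ with $A-\epsilon\in K$. A *linear prevision* is a map $P:\mathcal{L}\to\mathbb{R}$ with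 $P(u)\ge\inf u$, $P(\lambda u)=\lambda P(u)$ and $P(u+v)=P(u)+P(v)$ for all $u,v\in\mathcal{L}$ and real $\lambda>0$. For a set $\mathcal{M}$ of linear previsions, an option $u\in A$ is *E-admissible* in $A\in\mathcal{Q}$ if there is some $P\in\mathcal{M}$ with $P(u)\ge P(v)$ for all $v\in A$, and $R_{\mathcal{M}}(A)$ is the set of those $u\in A$ that are not E-admissible in $A$. **Theorem.** For every $K\subseteq\mathcal{Q}$ the following are equivalent: 1. $K$ is mixing and Archimedean; 2. there is a non-empty closed set $\mathcal{D}$ of mixing and Archimedean sets $D\subseteq\mathcal{L}$ such that $K=\bigcap_{D\in\mathcal{D}}K_D$; 3. there is a non-empty set $\mathcal{M}$ of linear previsions, closed in the topology of pointwise convergence on $\mathbb{R}^{\mathcal{L}}$, such that $K$ is the choice model of E-admissibility with respect to $\mathcal{M}$: for all $u\in\mathcal{L}$ and $A\in\mathcal{Q}$, $u\in R_{\mathcal{M}}(A\cup\{u\})$ if and only if $A-u\in K$. If these conditions hold, then the largest set $\mathcal{D}$ as in 2 is the set of all mixing and Archimedean $D\subseteq\mathcal{L}$ with $K\subseteq K_D$.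 -/

import Mathlib

noncomputable section

namespace Desirability

/-! Choice models on an abstract option space: a real vector space `V` with a set `pos` of
options that are positive in the background ordering. Option sets are finite subsets of `V`, the
empty set included. -/

section Abstract

variable {V : Type*} [AddCommGroup V] [Module ℝ V]

/-- `(a, b) > 0`: both are nonnegative and at least one of them is positive. -/
def PosPair (a b : ℝ) : Prop := 0 ≤ a ∧ 0 ≤ b ∧ 0 < a + b

/-- The set of all positive linear combinations (with at least one term) of elements of `S`. -/
def posi (S : Set V) : Set V :=
  {x | ∃ n : ℕ, 0 < n ∧ ∃ (c : Fin n → ℝ) (u : Fin n → V),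
    (∀ k, 0 < c k) ∧ (∀ k, u k ∈ S) ∧ x = ∑ k, c k • u k}

open Classical in
/-- The option set `A - v = {u - v : u ∈ A}`. -/
def shift (A : Finset V) (v : V) : Finset V := A.image fun u => u - v

open Classical in
/-- The option set `{lam u v • u + mu u v • v : u ∈ A₁, v ∈ A₂}`. -/
def combine (lam mu : V → V → ℝ) (A₁ A₂ : Finset V) : Finset V :=
  Finset.image₂ (fun u v => lam u v • u + mu u v • v) A₁ A₂

open Classical in
/-- Coherence of a set of desirable option sets. -/
structure IsCoherentSets (pos : Set V) (K : Set (Finset V)) : Prop where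
  erase_zero : ∀ A ∈ K, A.erase 0 ∈ K
  zero_notMem : ({0} : Finset V) ∉ K
  pos_mem : ∀ u ∈ pos, ({u} : Finset V) ∈ K
  cone : ∀ A₁ ∈ K, ∀ A₂ ∈ K, ∀ lam mu : V → V → ℝ,
    (∀ u ∈ A₁, ∀ v ∈ A₂, PosPair (lam u v) (mu u v)) → combine lam mu A₁ A₂ ∈ K
  mono : ∀ A₁ ∈ K, ∀ A₂ : Finset V, A₁ ⊆ A₂ → A₂ ∈ K

/-- Mixing sets of desirable option sets: coherent, and options that are positive linear
combinations of the remaining ones can be removed. -/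
structure IsMixingSets (pos : Set V) (K : Set (Finset V)) : Prop
    extends IsCoherentSets pos K where
  mixing : ∀ A B : Finset V, B ∈ K → A ⊆ B → (B : Set V) ⊆ posi (A : Set V) → A ∈ K

/-- Coherence of a set of desirable options. -/
structure IsCoherent (pos : Set V) (D : Set V) : Prop where
  zero_notMem : (0 : V) ∉ D
  pos_subset : pos ⊆ D
  cone : ∀ u ∈ D, ∀ v ∈ D, ∀ a b : ℝ, PosPair a b → a • u + b • v ∈ D

/-- Mixing sets of desirable options. -/
structure IsMixing (pos : Set V) (D : Set V) : Prop extends IsCoherent pos D where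
  mixing : ∀ A : Finset V, (posi (A : Set V) ∩ D).Nonempty → ((A : Set V) ∩ D).Nonempty

/-- The (binary) set of desirable option sets `K_D`: all option sets that meet `D`. -/
def setsOf (D : Set V) : Set (Finset V) := {A | ((A : Set V) ∩ D).Nonempty}

open Classical in
/-- The set of desirable option sets `K` and the rejection function `R` are connected:
`u ∈ R (A ∪ {u})` if and only if `A - u ∈ K`, for every option `u` and option set `A`. -/
def Connected (K : Set (Finset V)) (R : Finset V → Finset V) : Prop :=
  ∀ (u : V) (A : Finset V), u ∈ R (insert u A) ↔ shift A u ∈ K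

open Classical in
/-- The choice function of E-admissibility for a set `M` of expectation functionals: `u ∈ A` is
chosen from `A` when it maximises `P` over `A` for at least one `P ∈ M`. -/
def eAdmissible (M : Set (V → ℝ)) (A : Finset V) : Finset V :=
  A.filter fun u => ∃ P ∈ M, ∀ v ∈ A, P v ≤ P u

open Classical in
/-- The rejection function of E-admissibility. -/
def eRejected (M : Set (V → ℝ)) (A : Finset V) : Finset V := A \ eAdmissible M A

end Abstract

/-! Gambles on a set of states `X`. -/

section Gambles

variable (X : Type*)

/-- The vector space of gambles on `X`: the bounded real-valued maps on `X`, with pointwise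
operations. -/
def gambles : Submodule ℝ (X → ℝ) where
  carrier := {f | ∃ C : ℝ, ∀ x, |f x| ≤ C}
  zero_mem' := ⟨0, fun x => by simp⟩
  add_mem' := by
    rintro f g ⟨C, hC⟩ ⟨C', hC'⟩
    exact ⟨C + C', fun x => (abs_add_le _ _).trans (add_le_add (hC x) (hC' x))⟩
  smul_mem' := by
    rintro c f ⟨C, hC⟩
    refine ⟨|c| * C, fun x => ?_⟩
    simpa [abs_mul] using mul_le_mul_of_nonneg_left (hC x) (abs_nonneg c)

/-- Gambles on `X`. -/
abbrev Gamble : Type _ := gambles X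

variable {X}

/-- The constant gamble with value `r`. -/
def const (r : ℝ) : Gamble X := ⟨fun _ => r, |r|, fun _ => le_rfl⟩

variable (X) in
/-- The positive options: the gambles with strictly positive infimum. -/
def strictlyPositive : Set (Gamble X) := {u | 0 < ⨅ x, u.1 x}

/-- Archimedean sets of desirable gambles. -/
structure IsArchimedean (D : Set (Gamble X)) : Prop extends
    IsCoherent (strictlyPositive X) D where
  archimedean : ∀ u ∈ D, ∃ ε : ℝ, 0 < ε ∧ u - const ε ∈ D

/-- Archimedean sets of desirable sets of gambles. -/
structure IsArchimedeanSets (K : Set (Finset (Gamble X))) : Prop extends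
    IsCoherentSets (strictlyPositive X) K where
  archimedean : ∀ A ∈ K, ∃ ε : ℝ, 0 < ε ∧ shift A (const ε) ∈ K

variable (X) in
/-- The collection of all mixing and Archimedean sets of desirable gambles. -/
def mixingArchimedean : Set (Set (Gamble X)) :=
  {D | IsMixing (strictlyPositive X) D ∧ IsArchimedean D}

/-- The mixing and Archimedean sets of desirable gambles `D` with `K ⊆ K_D`. -/
def mixingArchimedeanAbove (K : Set (Finset (Gamble X))) : Set (Set (Gamble X)) :=
  {D ∈ mixingArchimedean X | K ⊆ setsOf D}

/-- Coherent lower previsions. -/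
structure IsCoherentLowerPrevision (P : Gamble X → ℝ) : Prop where
  inf_le : ∀ u, ⨅ x, u.1 x ≤ P u
  smul : ∀ u, ∀ a : ℝ, 0 < a → P (a • u) = a * P u
  superadditive : ∀ u v, P u + P v ≤ P (u + v)

/-- Linear previsions. -/
structure IsLinearPrevision (P : Gamble X → ℝ) : Prop extends IsCoherentLowerPrevision P where
  additive : ∀ u v, P (u + v) = P u + P v

/-- The lower prevision `u ↦ sup {r : u - r ∈ D}` of a set of desirable gambles. It is only used
for Archimedean `D` (and non-empty `X`), where the supremum is that of a non-empty set of reals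
that is bounded above. -/
def lowerPrevision (D : Set (Gamble X)) (u : Gamble X) : ℝ := sSup {r : ℝ | u - const r ∈ D}

/-- A family of Archimedean sets of desirable gambles is closed when it contains all its limit
points, that is, every Archimedean `D` whose lower prevision belongs to the closure, for the
topology of pointwise convergence on `Gamble X → ℝ`, of the set of lower previsions of the
members of the family. -/
def IsClosedFamily (𝒟 : Set (Set (Gamble X))) : Prop :=
  ∀ D, IsArchimedean D → lowerPrevision D ∈ closure (lowerPrevision '' 𝒟) → D ∈ 𝒟

/-- `𝒟` is a non-empty closed family of mixing and Archimedean sets of desirable gambles such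
that `K` is the intersection of the `K_D`, `D ∈ 𝒟`. -/
structure Represents (𝒟 : Set (Set (Gamble X))) (K : Set (Finset (Gamble X))) : Prop where
  nonempty : 𝒟.Nonempty
  subset : 𝒟 ⊆ mixingArchimedean X
  closed : IsClosedFamily 𝒟
  eq_iInter : K = ⋂ D ∈ 𝒟, setsOf D

end Gambles

end Desirability

end

/-!
A linear prevision `P` and the mixing Archimedean set `D_P = {u | 0 < P u}` determine each other,
`P` being the lower prevision of `D_P`, so that E-admissibility with respect to `M` is
representation by the family of the `D_P`, `P ∈ M`.

That `K` is the intersection of the `K_{D_P}` comes down to finding, for each `A ∉ K`, a linear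
prevision that is nonpositive on `A` and positive somewhere on every member of `K`. By mixingness,
the cone spanned by `A` includes no member of `K`. Let `N` be a maximal such cone containing `A`.
If `-a ∉ N` for all `a` in some `B ∈ K`, then each cone `N + ℝ≥0 • (-a)` includes a member of `K`,
and combining these members with `B` yields one that `N` includes; hence `N` contains the opposite
of some option in each member of `K`. Riesz extension gives a linear prevision that is nonpositive
on `N`, thus nonnegative somewhere on every member of `K`, and positive there because `K` is
Archimedean.

Conversely, the linear previsions form a compact set, so when all `P` in a closed `M` find an
option of positive value in the finite `A`, these values are bounded away from zero uniformly in
`P`: this makes the model of E-admissibility Archimedean.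
-/

namespace Desirability

section Abstract

variable {V : Type*}

/-- The options of positive value under `P`: the set `D_P` of desirable options that an
expectation functional `P` determines. -/
def desirableBy (P : V → ℝ) : Set V := {u | 0 < P u}

/-- The option sets in which every `P ∈ M` finds an option of positive value: the set of desirable
option sets that corresponds to E-admissibility with respect to `M`. -/
def desirableSetsBy (M : Set (V → ℝ)) : Set (Finset V) := ⋂ P ∈ M, setsOf (desirableBy P)

theorem mem_desirableSetsBy {M : Set (V → ℝ)} {A : Finset V} :
    A ∈ desirableSetsBy M ↔ ∀ P ∈ M, ∃ u ∈ A, 0 < P u :=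
  Set.mem_iInter₂

theorem mem_biInter_setsOf {𝒟 : Set (Set V)} {A : Finset V} :
    A ∈ ⋂ D ∈ 𝒟, setsOf D ↔ ∀ D ∈ 𝒟, ∃ u ∈ A, u ∈ D :=
  Set.mem_iInter₂

variable [AddCommGroup V]

theorem mem_shift {A : Finset V} {v w : V} : w ∈ shift A v ↔ ∃ u ∈ A, u - v = w := by
  classical
  simp [shift]

theorem connected_eRejected_iff {K : Set (Finset V)} {M : Set (V → ℝ)}
    (hM : ∀ P ∈ M, ∀ u v, P (u - v) = P u - P v) :
    Connected K (eRejected M) ↔ K = desirableSetsBy M := by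
  classical
  have connected : Connected (desirableSetsBy M) (eRejected M) := fun u A => by
    have rejected_iff : u ∈ eRejected M (insert u A) ↔ ∀ P ∈ M, ∃ v ∈ A, P u < P v := by
      simp [eRejected, eAdmissible]
    rw [rejected_iff, mem_desirableSetsBy]
    exact forall₂_congr fun P hP => by simp [mem_shift, hM P hP]
  refine ⟨fun h => ?_, fun h => h ▸ connected⟩
  ext A
  simpa [shift] using (h 0 A).symm.trans (connected 0 A)

variable [Module ℝ V]

theorem mem_combine {lam mu : V → V → ℝ} {A B : Finset V} {w : V} :
    w ∈ combine lam mu A B ↔ ∃ u ∈ A, ∃ v ∈ B, lam u v • u + mu u v • v = w := by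
  classical
  simp [combine]

theorem subset_posi (S : Set V) : S ⊆ posi S := fun x hx =>
  ⟨1, one_pos, fun _ => 1, fun _ => x, fun _ => one_pos, fun _ => hx, by simp⟩

theorem add_mem_posi_pair (u v : V) : u + v ∈ posi {u, v} :=
  ⟨2, two_pos, 1, ![u, v], fun _ => one_pos, by simp [Fin.forall_fin_two], by simp⟩

theorem mem_posi_of_mem_hull {S : Set V} {x : V} (hx : x ∈ PointedCone.hull ℝ S) (hx0 : x ≠ 0) :
    x ∈ posi S := by
  obtain ⟨c, hcS, hc, rfl⟩ := PointedCone.mem_hull_set.1 hx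
  have hsupp : c.support.Nonempty := Finsupp.support_nonempty_iff.2 fun h => hx0 (by simp [h])
  let e := c.support.equivFin.symm
  refine ⟨c.support.card, hsupp.card_pos, fun k => c (e k), fun k => e k, fun k => ?_,
    fun k => hcS (e k).2, ?_⟩
  · exact (hc _).lt_of_ne' (Finsupp.mem_support_iff.1 (e k).2)
  · rw [e.sum_comp fun v : c.support => c v • (v : V), Finsupp.sum,
      Finset.sum_coe_sort _ fun v => c v • v]

theorem exists_pos_of_mem_posi (f : V →ₗ[ℝ] ℝ) {S : Set V} {x : V} (hx : x ∈ posi S)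
    (hfx : 0 < f x) : ∃ u ∈ S, 0 < f u := by
  obtain ⟨n, -, c, u, hc, hu, rfl⟩ := hx
  by_contra! hS
  refine hfx.not_ge ?_
  simp only [map_sum, map_smul, smul_eq_mul]
  exact Finset.sum_nonpos fun k _ => mul_nonpos_of_nonneg_of_nonpos (hc k).le (hS _ (hu k))

variable {pos : Set V}

section Options

variable {D : Set V} {u v : V} {a : ℝ}

theorem IsCoherent.add_mem (hD : IsCoherent pos D) (hu : u ∈ D) (hv : v ∈ D) : u + v ∈ D := by
  simpa using hD.cone u hu v hv 1 1 ⟨zero_le_one, zero_le_one, by norm_num⟩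

theorem IsCoherent.smul_mem (hD : IsCoherent pos D) (ha : 0 < a) (hu : u ∈ D) : a • u ∈ D := by
  simpa using hD.cone u hu u hu a 0 ⟨ha.le, le_rfl, by simpa⟩

theorem IsCoherent.smul_mem_iff (hD : IsCoherent pos D) (ha : 0 < a) : a • u ∈ D ↔ u ∈ D :=
  ⟨fun h => by simpa [smul_smul, ha.ne'] using hD.smul_mem (inv_pos.2 ha) h, hD.smul_mem ha⟩

theorem IsMixing.mem_or_mem_of_add_mem (hD : IsMixing pos D) (h : u + v ∈ D) :
    u ∈ D ∨ v ∈ D := by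
  classical
  obtain ⟨w, hw, hwD⟩ := hD.mixing {u, v} ⟨u + v, by simpa using add_mem_posi_pair u v, h⟩
  obtain rfl | rfl : w = u ∨ w = v := by simpa using hw
  exacts [.inl hwD, .inr hwD]

theorem isMixing_desirableBy (f : V →ₗ[ℝ] ℝ) (hf : ∀ u ∈ pos, 0 < f u) :
    IsMixing pos (desirableBy f) where
  zero_notMem := by simp [desirableBy]
  pos_subset := hf
  cone := by
    rintro u (hu : 0 < f u) v (hv : 0 < f v) a b ⟨ha, hb, hab⟩
    change 0 < f (a • u + b • v)
    simp only [map_add, map_smul, smul_eq_mul]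
    rcases ha.eq_or_lt with rfl | ha
    · simpa using mul_pos (by simpa using hab) hv
    · exact add_pos_of_pos_of_nonneg (mul_pos ha hu) (mul_nonneg hb hv.le)
  mixing := fun _ ⟨_, hxA, hx⟩ => exists_pos_of_mem_posi f hxA hx

end Options

section Intersections

variable {𝒟 : Set (Set V)}

theorem isCoherentSets_biInter_setsOf (hne : 𝒟.Nonempty) (h𝒟 : ∀ D ∈ 𝒟, IsCoherent pos D) :
    IsCoherentSets pos (⋂ D ∈ 𝒟, setsOf D) := by
  classical
  constructor <;> simp only [mem_biInter_setsOf]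
  case erase_zero =>
    intro A hA D hD
    obtain ⟨u, huA, huD⟩ := hA D hD
    have hu0 : u ≠ 0 := ne_of_mem_of_not_mem huD (h𝒟 D hD).zero_notMem
    exact ⟨u, Finset.mem_erase.2 ⟨hu0, huA⟩, huD⟩
  case zero_notMem =>
    obtain ⟨D, hD⟩ := hne
    intro h
    exact (h𝒟 D hD).zero_notMem (by simpa using h D hD)
  case pos_mem =>
    exact fun u hu D hD => ⟨u, Finset.mem_singleton_self u, (h𝒟 D hD).pos_subset hu⟩
  case cone =>
    intro A₁ h₁ A₂ h₂ lam mu hlm D hD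
    obtain ⟨u, hu, huD⟩ := h₁ D hD
    obtain ⟨v, hv, hvD⟩ := h₂ D hD
    exact ⟨_, mem_combine.2 ⟨u, hu, v, hv, rfl⟩,
      (h𝒟 D hD).cone u huD v hvD _ _ (hlm u hu v hv)⟩
  case mono =>
    exact fun A₁ h₁ A₂ hsub D hD => (h₁ D hD).imp fun u hu => ⟨hsub hu.1, hu.2⟩

theorem isMixingSets_biInter_setsOf (hne : 𝒟.Nonempty) (h𝒟 : ∀ D ∈ 𝒟, IsMixing pos D) :
    IsMixingSets pos (⋂ D ∈ 𝒟, setsOf D) where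
  toIsCoherentSets :=
    isCoherentSets_biInter_setsOf hne fun D hD => (h𝒟 D hD).toIsCoherent
  mixing := by
    simp only [mem_biInter_setsOf]
    intro A B hB _ hBA D hD
    obtain ⟨u, hu, huD⟩ := hB D hD
    exact (h𝒟 D hD).mixing A ⟨u, hBA hu, huD⟩

end Intersections

section ConsistentCones

variable {K : Set (Finset V)}

open Classical in
theorem IsCoherentSets.erase_union_image_mem (hK : IsCoherentSets pos K) {A B : Finset V}
    (hA : A ∈ K) (hB : B ∈ K) (a : V) {l m : V → ℝ} (hlm : ∀ b ∈ B, PosPair (l b) (m b)) :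
    A.erase a ∪ B.image (fun b => l b • a + m b • b) ∈ K := by
  refine hK.mono _ (hK.cone A hA B hB (fun u v => if u = a then l v else 1)
    (fun u v => if u = a then m v else 0) fun u _ v hv => ?_) _ fun x hx => ?_
  · split_ifs
    · exact hlm v hv
    · exact ⟨zero_le_one, le_rfl, by norm_num⟩
  · obtain ⟨u, hu, v, hv, rfl⟩ := mem_combine.1 hx
    by_cases hua : u = a
    · exact Finset.mem_union_right _ (Finset.mem_image.2 ⟨v, hv, by simp [hua]⟩)
    · exact Finset.mem_union_left _ (by simp [hua, hu])

open Classical in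
theorem IsCoherentSets.biUnion_image_mem (hK : IsCoherentSets pos K) {A : Finset V} (hA : A ∈ K)
    {B : V → Finset V} {l m : V → V → ℝ} (hB : ∀ a ∈ A, B a ∈ K)
    (hlm : ∀ a ∈ A, ∀ b ∈ B a, PosPair (l a b) (m a b)) :
    A.biUnion (fun a => (B a).image fun b => l a b • a + m a b • b) ∈ K := by
  set F : V → Finset V := fun a => (B a).image fun b => l a b • a + m a b • b
  suffices replace : ∀ S ⊆ A, ∀ T, S ∪ T ∈ K → S.biUnion F ∪ T ∈ K by
    simpa using replace A subset_rfl ∅ (by simpa using hA)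
  intro S
  induction S using Finset.induction with
  | empty => simp
  | insert a S _ ih =>
    intro hS T hT
    have haA : a ∈ A := hS (Finset.mem_insert_self a S)
    have hreplaced : (insert a S ∪ T).erase a ∪ F a ∈ K :=
      hK.erase_union_image_mem hT (hB a haA) a (hlm a haA)
    rw [Finset.biUnion_insert, Finset.union_comm (F a), Finset.union_assoc]
    refine ih ((Finset.subset_insert a S).trans hS) _ (hK.mono _ hreplaced _ ?_)
    grind

/-- A cone `N` of options is consistent with `K` when it includes no member of `K`, so that the
options in `N` can all be declared undesirable without contradicting `K`. -/
def ConsistentWith (K : Set (Finset V)) (N : PointedCone ℝ V) : Prop :=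
  ∀ A ∈ K, ¬(A : Set V) ⊆ N

theorem ConsistentWith.exists_le_maximal {N₀ : PointedCone ℝ V} (h₀ : ConsistentWith K N₀) :
    ∃ N, N₀ ≤ N ∧ Maximal (ConsistentWith K) N := by
  refine zorn_le_nonempty₀ {N | ConsistentWith K N}
    (fun c hc hchain N hN => ⟨sSup c, fun A hA hAc => ?_, fun _ => le_sSup⟩) N₀ h₀
  have hdir := hchain.directedOn
  have hcover : (A : Set V) ⊆ ⋃ N ∈ c, (N : Set V) := fun a ha => by
    simpa using (Submodule.mem_sSup_of_directed ⟨N, hN⟩ hdir).1 (hAc ha)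
  obtain ⟨N', hN', hAN'⟩ :=
    DirectedOn.exists_mem_subset_of_finset_subset_biUnion ⟨N, hN⟩ hdir hcover
  exact hc hN' A hA hAN'

theorem IsCoherentSets.exists_neg_mem_of_maximal (hK : IsCoherentSets pos K)
    {N : PointedCone ℝ V} (hN : Maximal (ConsistentWith K) N) {A : Finset V} (hA : A ∈ K) :
    ∃ a ∈ A, -a ∈ N := by
  classical
  by_contra! hneg
  have hinconsistent : ∀ a ∈ A, ∃ B ∈ K,
      (B : Set V) ⊆ (N ⊔ PointedCone.hull ℝ {-a} : PointedCone ℝ V) := by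
    intro a ha
    by_contra! hcons
    exact hneg a ha (hN.le_of_ge hcons le_sup_left
      (Submodule.mem_sup_right (Submodule.mem_span_singleton_self _)))
  choose! B hBK hBN using hinconsistent
  have hadd : ∀ a ∈ A, ∀ b ∈ B a, ∃ l : ℝ, 0 ≤ l ∧ l • a + b ∈ N := by
    intro a ha b hb
    obtain ⟨n, hn, y, hy, hnyb⟩ := Submodule.mem_sup.1 (hBN a ha hb)
    obtain ⟨l, rfl⟩ := Submodule.mem_span_singleton.1 hy
    have hl : n = (l : ℝ) • a + b := by
      rw [← hnyb, smul_neg]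
      exact (add_add_neg_cancel'_right _ _).symm
    exact ⟨l, l.2, hl ▸ hn⟩
  choose! l hl0 hlN using hadd
  refine hN.prop _ (hK.biUnion_image_mem hA hBK (l := l) (m := fun _ _ => 1)
    fun a ha b hb => ⟨hl0 a ha b hb, zero_le_one, by linarith [hl0 a ha b hb]⟩) fun x hx => ?_
  obtain ⟨a, ha, b, hb, rfl⟩ : ∃ a ∈ A, ∃ b ∈ B a, l a b • a + b = x := by simpa using hx
  exact hlN a ha b hb

theorem IsMixingSets.consistentWith_hull (hK : IsMixingSets pos K) {A : Finset V} (hA : A ∉ K) :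
    ConsistentWith K (PointedCone.hull ℝ (A : Set V)) := by
  classical
  intro B hB hBA
  refine hA (hK.mixing A (A ∪ B.erase 0) (hK.mono _ (hK.erase_zero B hB) _
    Finset.subset_union_right) Finset.subset_union_left fun x hx => ?_)
  rcases Finset.mem_union.1 hx with hxA | hxB
  · exact subset_posi _ hxA
  · obtain ⟨hx0, hxB⟩ := Finset.mem_erase.1 hxB
    exact mem_posi_of_mem_hull (hBA hxB) hx0

end ConsistentCones

theorem exists_linearMap_nonneg_of_orderUnit (S : PointedCone ℝ V) (e : V)
    (hneg : ∀ r : ℝ, r • e ∈ S → 0 ≤ r) (hunit : ∀ v, ∃ r : ℝ, r • e + v ∈ S) :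
    ∃ f : V →ₗ[ℝ] ℝ, f e = 1 ∧ ∀ v ∈ S, 0 ≤ f v := by
  have he : e ≠ 0 := by
    rintro rfl
    linarith [hneg (-1) (by simp)]
  let f₀ : V →ₗ.[ℝ] ℝ := LinearPMap.mkSpanSingleton e 1 he
  have hf₀ : ∀ (r : ℝ) (hr : r • e ∈ f₀.domain), f₀ ⟨r • e, hr⟩ = r := fun r hr =>
    (LinearPMap.mkSpanSingleton'_apply (σ := RingHom.id ℝ) e (1 : ℝ) _ r hr).trans (mul_one r)
  obtain ⟨f, hf, hfS⟩ := riesz_extension S f₀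
    (by
      rintro ⟨y, hy⟩ hyS
      obtain ⟨r, rfl⟩ := Submodule.mem_span_singleton.1 hy
      simpa [hf₀] using hneg r hyS)
    fun v => by
      obtain ⟨r, hr⟩ := hunit v
      exact ⟨⟨r • e, Submodule.mem_span_singleton.2 ⟨r, rfl⟩⟩, hr⟩
  exact ⟨f, (hf ⟨e, _⟩).trans (LinearPMap.mkSpanSingleton_apply ℝ ℝ he 1), hfS⟩

end Abstract

theorem exists_pos_forall_exists_lt {ι : Type*} {M : Set (ι → ℝ)} (hM : IsCompact M)
    {A : Finset ι} (hA : ∀ P ∈ M, ∃ u ∈ A, 0 < P u) :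
    ∃ ε > 0, ∀ P ∈ M, ∃ u ∈ A, ε < P u := by
  rcases M.eq_empty_or_nonempty with rfl | ⟨P₀, hP₀⟩
  · exact ⟨1, one_pos, by simp⟩
  have hne : A.Nonempty := (hA P₀ hP₀).imp fun _ h => h.1
  obtain ⟨δ, hδ, hmin⟩ := hM.exists_forall_le'
    (f := fun P => A.sup' hne P) (a := 0)
    (Continuous.finset_sup'_apply hne fun u _ => continuous_apply u).continuousOn
    fun P hP => (Finset.lt_sup'_iff hne).2 (hA P hP)
  exact ⟨δ / 2, half_pos hδ, fun P hP =>
    (Finset.lt_sup'_iff hne).1 ((half_lt_self hδ).trans_le (hmin P hP))⟩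

section Gambles

variable {X : Type*}

theorem const_add (r s : ℝ) : (const (r + s) : Gamble X) = const r + const s := rfl

theorem const_neg (r : ℝ) : (const (-r) : Gamble X) = -const r := rfl

theorem const_zero : (const 0 : Gamble X) = 0 := rfl

theorem smul_const (r s : ℝ) : r • (const s : Gamble X) = const (r * s) := rfl

section LinearPrevisions

variable {P : Gamble X → ℝ}

theorem IsLinearPrevision.map_zero (hP : IsLinearPrevision P) : P 0 = 0 :=
  (AddMonoidHom.mk' P hP.additive).map_zero

theorem IsLinearPrevision.map_neg (hP : IsLinearPrevision P) (u : Gamble X) : P (-u) = -P u :=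
  (AddMonoidHom.mk' P hP.additive).map_neg u

theorem IsLinearPrevision.map_sub (hP : IsLinearPrevision P) (u v : Gamble X) :
    P (u - v) = P u - P v :=
  (AddMonoidHom.mk' P hP.additive).map_sub u v

theorem IsLinearPrevision.map_smul (hP : IsLinearPrevision P) (a : ℝ) (u : Gamble X) :
    P (a • u) = a * P u := by
  rcases lt_trichotomy a 0 with ha | rfl | ha
  · have hneg := hP.smul u (-a) (neg_pos.2 ha)
    rw [neg_smul a u, hP.map_neg] at hneg
    linarith
  · simp [hP.map_zero]
  · exact hP.smul u a ha

/-- A linear prevision as a linear functional. -/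
def IsLinearPrevision.toLinearMap (hP : IsLinearPrevision P) : Gamble X →ₗ[ℝ] ℝ where
  toFun := P
  map_add' := hP.additive
  map_smul' := hP.map_smul

theorem isLinearPrevision_iff : IsLinearPrevision P ↔
    (∀ u, ⨅ x, u.1 x ≤ P u) ∧ (∀ u, ∀ a : ℝ, 0 < a → P (a • u) = a * P u) ∧
      ∀ u v, P (u + v) = P u + P v :=
  ⟨fun h => ⟨h.inf_le, h.smul, h.additive⟩,
    fun ⟨hinf, hsmul, hadd⟩ => ⟨⟨hinf, hsmul, fun u v => (hadd u v).ge⟩, hadd⟩⟩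

theorem isClosed_setOf_isLinearPrevision : IsClosed {P : Gamble X → ℝ | IsLinearPrevision P} := by
  simp only [isLinearPrevision_iff, Set.ofPred_and, Set.ofPred_forall]
  refine .inter ?_ (.inter ?_ ?_)
  · exact isClosed_iInter fun u => isClosed_le continuous_const (continuous_apply u)
  · exact isClosed_iInter fun u => isClosed_iInter fun a => isClosed_iInter fun _ =>
      isClosed_eq (continuous_apply _) (continuous_const.mul (continuous_apply u))
  · exact isClosed_iInter fun u => isClosed_iInter fun v =>
      isClosed_eq (continuous_apply _) ((continuous_apply u).add (continuous_apply v))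

theorem isCompact_setOf_isLinearPrevision :
    IsCompact {P : Gamble X → ℝ | IsLinearPrevision P} := by
  refine (isCompact_univ_pi fun u : Gamble X =>
    isCompact_Icc (a := ⨅ x, u.1 x) (b := -⨅ x, (-u).1 x)).of_isClosed_subset
      isClosed_setOf_isLinearPrevision fun P (hP : IsLinearPrevision P) u _ =>
        ⟨hP.inf_le u, le_neg_of_le_neg ?_⟩
  exact hP.map_neg u ▸ hP.inf_le (-u)

theorem IsLinearPrevision.isMixing_desirableBy (hP : IsLinearPrevision P) :
    IsMixing (strictlyPositive X) (desirableBy P) :=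
  Desirability.isMixing_desirableBy hP.toLinearMap fun u hu => lt_of_lt_of_le hu (hP.inf_le u)

end LinearPrevisions

variable {K : Set (Finset (Gamble X))} {M : Set (Gamble X → ℝ)} {𝒟 : Set (Set (Gamble X))}

theorem Represents.subset_mixingArchimedeanAbove (h : Represents 𝒟 K) :
    𝒟 ⊆ mixingArchimedeanAbove K :=
  fun _ hD => ⟨h.subset hD, h.eq_iInter ▸ Set.biInter_subset_of_mem hD⟩

/-- The counterpart of `Represents` for linear previsions: `M` is a non-empty closed set of linear
previsions, and `K` is the set of desirable option sets that corresponds to it. -/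
structure RepresentsByPrevisions (M : Set (Gamble X → ℝ)) (K : Set (Finset (Gamble X))) :
    Prop where
  nonempty : M.Nonempty
  isLinearPrevision : ∀ P ∈ M, IsLinearPrevision P
  isClosed : IsClosed M
  eq_desirableSetsBy : K = desirableSetsBy M

theorem RepresentsByPrevisions.isMixingSets (h : RepresentsByPrevisions M K) :
    IsMixingSets (strictlyPositive X) K := by
  rw [h.eq_desirableSetsBy, desirableSetsBy, ← Set.biInter_image]
  exact isMixingSets_biInter_setsOf (h.nonempty.image _) (Set.forall_mem_image.2 fun P hP =>
    (h.isLinearPrevision P hP).isMixing_desirableBy)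

variable [Nonempty X] {P : Gamble X → ℝ} {D : Set (Gamble X)}

theorem const_mem_strictlyPositive {r : ℝ} (hr : 0 < r) :
    (const r : Gamble X) ∈ strictlyPositive X := by
  simpa [strictlyPositive, const] using hr

theorem sub_const_mem_strictlyPositive_iff {u : Gamble X} {r : ℝ} :
    u - const r ∈ strictlyPositive X ↔ r < ⨅ x, u.1 x := by
  obtain ⟨C, hC⟩ := u.2
  have hbdd : BddBelow (Set.range u.1) :=
    ⟨-C, Set.forall_mem_range.2 fun x => (abs_le.1 (hC x)).1⟩
  have hinf : ⨅ x, (u - const r).1 x = (⨅ x, u.1 x) - r := (ciInf_sub hbdd r).symm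
  change 0 < ⨅ x, (u - const r).1 x ↔ _
  rw [hinf, sub_pos]

theorem IsLinearPrevision.map_const (hP : IsLinearPrevision P) (r : ℝ) : P (const r) = r := by
  have hle : ∀ s : ℝ, s ≤ P (const s) := fun s => by simpa [const] using hP.inf_le (const s)
  refine le_antisymm ?_ (hle r)
  simpa [const_neg, hP.map_neg] using hle (-r)

theorem isLinearPrevision_of_nonneg (f : Gamble X →ₗ[ℝ] ℝ) (hone : f (const 1) = 1)
    (hnonneg : ∀ u ∈ strictlyPositive X, 0 ≤ f u) : IsLinearPrevision f where
  inf_le u := le_of_forall_lt_imp_le_of_dense fun r hr => by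
    have hconst : f (const r) = r := by
      rw [← mul_one r, ← smul_const, _root_.map_smul, hone, smul_eq_mul]
    simpa [hconst] using hnonneg _ (sub_const_mem_strictlyPositive_iff.2 hr)
  smul u a _ := by simp
  superadditive u v := by simp
  additive u v := by simp

theorem exists_isLinearPrevision_nonpos (N : PointedCone ℝ (Gamble X))
    (hneg : ∀ u ∈ strictlyPositive X, -u ∈ N) (hpos : ∀ u ∈ strictlyPositive X, u ∉ N) :
    ∃ P : Gamble X → ℝ, IsLinearPrevision P ∧ ∀ u ∈ N, P u ≤ 0 := by
  obtain ⟨f, hf, hfN⟩ := exists_linearMap_nonneg_of_orderUnit N (const (-1))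
    (fun r hr => by
      by_contra! hr0
      refine hpos _ (const_mem_strictlyPositive (neg_pos.2 hr0)) ?_
      simpa [smul_const] using hr)
    fun v => by
      have hmem := hneg _ (sub_const_mem_strictlyPositive_iff.2 (sub_one_lt (⨅ x, (-v).1 x)))
      refine ⟨1 - ⨅ x, (-v).1 x, ?_⟩
      rw [smul_const, mul_neg_one, neg_sub]
      rwa [neg_sub, sub_neg_eq_add] at hmem
  refine ⟨-f, isLinearPrevision_of_nonneg (-f) ?_ fun u hu => ?_, fun u hu => ?_⟩
  · rwa [LinearMap.neg_apply, ← _root_.map_neg, ← const_neg]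
  · simpa using hfN _ (hneg u hu)
  · simpa using hfN u hu

section LowerPrevisions

variable {u : Gamble X} {r : ℝ}

theorem IsCoherent.sub_const_mem_of_lt_iInf (hD : IsCoherent (strictlyPositive X) D)
    (hr : r < ⨅ x, u.1 x) : u - const r ∈ D :=
  hD.pos_subset (sub_const_mem_strictlyPositive_iff.2 hr)

theorem IsCoherent.le_lowerPrevision (hD : IsCoherent (strictlyPositive X) D)
    (hr : u - const r ∈ D) : r ≤ lowerPrevision D u := by
  refine le_csSup ⟨-⨅ x, (-u).1 x, fun s (hs : u - const s ∈ D) => ?_⟩ hr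
  by_contra! hlt
  have hs' : -u - const (-s) ∈ D := hD.sub_const_mem_of_lt_iInf (neg_lt.1 hlt)
  exact hD.zero_notMem (by simpa [const_neg] using hD.add_mem hs hs')

theorem IsCoherent.sub_const_mem_of_lt_lowerPrevision (hD : IsCoherent (strictlyPositive X) D)
    (hr : r < lowerPrevision D u) : u - const r ∈ D := by
  have hne : {s : ℝ | u - const s ∈ D}.Nonempty :=
    ⟨_, hD.sub_const_mem_of_lt_iInf (sub_one_lt (⨅ x, u.1 x))⟩
  obtain ⟨s, hs, hrs⟩ := exists_lt_of_lt_csSup hne hr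
  have hconst : (const s : Gamble X) = const r + const (s - r) := by
    rw [← const_add, add_sub_cancel]
  have hsum := hD.add_mem hs (hD.pos_subset (const_mem_strictlyPositive (sub_pos.2 hrs)))
  rwa [hconst, sub_add_eq_sub_sub, sub_add_cancel] at hsum

open scoped Pointwise in
theorem IsCoherent.isCoherentLowerPrevision (hD : IsCoherent (strictlyPositive X) D) :
    IsCoherentLowerPrevision (lowerPrevision D) where
  inf_le u := le_of_forall_lt_imp_le_of_dense fun _ hr =>
    hD.le_lowerPrevision (hD.sub_const_mem_of_lt_iInf hr)
  smul u a ha := by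
    have hset : {r : ℝ | a • u - const r ∈ D} = a • {r : ℝ | u - const r ∈ D} := by
      ext r
      rw [Set.mem_smul_set_iff_inv_smul_mem₀ ha.ne']
      change _ ↔ u - const (a⁻¹ * r) ∈ D
      rw [← hD.smul_mem_iff ha, smul_sub, smul_const, mul_inv_cancel_left₀ ha.ne']
      rfl
    rw [lowerPrevision, hset, Real.sSup_smul_of_nonneg ha.le, smul_eq_mul, lowerPrevision]
  superadditive u v := add_le_of_forall_lt fun r hr s hs => by
    refine hD.le_lowerPrevision ?_
    rw [const_add, add_sub_add_comm]
    exact hD.add_mem (hD.sub_const_mem_of_lt_lowerPrevision hr)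
      (hD.sub_const_mem_of_lt_lowerPrevision hs)

theorem IsArchimedean.sub_const_mem_iff (hD : IsArchimedean D) :
    u - const r ∈ D ↔ r < lowerPrevision D u := by
  refine ⟨fun h => ?_, hD.sub_const_mem_of_lt_lowerPrevision⟩
  obtain ⟨ε, hε, hu⟩ := hD.archimedean _ h
  rw [sub_sub, ← const_add] at hu
  exact (lt_add_of_pos_right r hε).trans_le (hD.le_lowerPrevision hu)

end LowerPrevisions

section Correspondence

theorem IsLinearPrevision.isArchimedean_desirableBy (hP : IsLinearPrevision P) :
    IsArchimedean (desirableBy P) where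
  toIsCoherent := hP.isMixing_desirableBy.toIsCoherent
  archimedean u hu := by
    refine ⟨P u / 2, half_pos hu, ?_⟩
    change 0 < P (u - const (P u / 2))
    rw [hP.map_sub, hP.map_const]
    exact sub_pos.2 (half_lt_self hu)

theorem IsLinearPrevision.desirableBy_mem_mixingArchimedean (hP : IsLinearPrevision P) :
    desirableBy P ∈ mixingArchimedean X :=
  ⟨hP.isMixing_desirableBy, hP.isArchimedean_desirableBy⟩

theorem IsLinearPrevision.lowerPrevision_desirableBy (hP : IsLinearPrevision P) :
    lowerPrevision (desirableBy P) = P := by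
  ext u
  have hset : {r : ℝ | u - const r ∈ desirableBy P} = Set.Iio (P u) := by
    ext r
    simp [desirableBy, hP.map_sub, hP.map_const]
  rw [lowerPrevision, hset, csSup_Iio]

theorem IsArchimedean.desirableBy_lowerPrevision (hD : IsArchimedean D) :
    desirableBy (lowerPrevision D) = D := by
  ext u
  change 0 < lowerPrevision D u ↔ u ∈ D
  simpa [const_zero] using (hD.sub_const_mem_iff (u := u) (r := 0)).symm

theorem isLinearPrevision_lowerPrevision (hD : D ∈ mixingArchimedean X) :
    IsLinearPrevision (lowerPrevision D) := by
  obtain ⟨hmix, harch⟩ := hD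
  have hlower := harch.isCoherentLowerPrevision
  refine ⟨hlower, fun u v => le_antisymm ?_ (hlower.superadditive u v)⟩
  by_contra! hlt
  have hsum := harch.sub_const_mem_iff.2 hlt
  rw [const_add, add_sub_add_comm] at hsum
  rcases hmix.mem_or_mem_of_add_mem hsum with h | h <;>
    exact lt_irrefl _ (harch.sub_const_mem_iff.1 h)

end Correspondence

section Representation

theorem RepresentsByPrevisions.isArchimedeanSets (h : RepresentsByPrevisions M K) :
    IsArchimedeanSets K where
  toIsCoherentSets := h.isMixingSets.toIsCoherentSets
  archimedean A hA := by
    simp only [h.eq_desirableSetsBy, mem_desirableSetsBy] at hA ⊢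
    have hcompact : IsCompact M :=
      isCompact_setOf_isLinearPrevision.of_isClosed_subset h.isClosed h.isLinearPrevision
    obtain ⟨ε, hε, hAε⟩ := exists_pos_forall_exists_lt hcompact hA
    refine ⟨ε, hε, fun P hP => ?_⟩
    obtain ⟨u, hu, hPu⟩ := hAε P hP
    have hlin := h.isLinearPrevision P hP
    refine ⟨u - const ε, mem_shift.2 ⟨u, hu, rfl⟩, ?_⟩
    rwa [hlin.map_sub, hlin.map_const, sub_pos]

theorem RepresentsByPrevisions.represents (h : RepresentsByPrevisions M K) :
    Represents (desirableBy '' M) K where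
  nonempty := h.nonempty.image _
  subset := Set.image_subset_iff.2 fun P hP =>
    (h.isLinearPrevision P hP).desirableBy_mem_mixingArchimedean
  closed D hD hclosure := by
    rw [Set.image_image, Set.image_congr fun P hP =>
      (h.isLinearPrevision P hP).lowerPrevision_desirableBy, Set.image_id',
      h.isClosed.closure_eq] at hclosure
    exact ⟨_, hclosure, hD.desirableBy_lowerPrevision⟩
  eq_iInter := by rw [Set.biInter_image, h.eq_desirableSetsBy, desirableSetsBy]

theorem Represents.representsByPrevisions (h : Represents 𝒟 K) :
    RepresentsByPrevisions (lowerPrevision '' 𝒟) K := by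
  have hlin : ∀ P ∈ lowerPrevision '' 𝒟, IsLinearPrevision P :=
    Set.forall_mem_image.2 fun D hD => isLinearPrevision_lowerPrevision (h.subset hD)
  refine ⟨h.nonempty.image _, hlin, isClosed_of_closure_subset fun P hP => ?_, ?_⟩
  · have hPlin : IsLinearPrevision P :=
      closure_minimal hlin isClosed_setOf_isLinearPrevision hP
    refine ⟨desirableBy P, h.closed _ hPlin.isArchimedean_desirableBy ?_,
      hPlin.lowerPrevision_desirableBy⟩
    rwa [hPlin.lowerPrevision_desirableBy]
  · rw [h.eq_iInter, desirableSetsBy, Set.biInter_image]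
    exact Set.iInter₂_congr fun D hD => by rw [(h.subset hD).2.desirableBy_lowerPrevision]

/-- The linear previsions that are positive on some option of each desirable option set: the
largest set of linear previsions that can represent `K`. -/
def compatiblePrevisions (K : Set (Finset (Gamble X))) : Set (Gamble X → ℝ) :=
  {P | IsLinearPrevision P ∧ ∀ A ∈ K, ∃ u ∈ A, 0 < P u}

theorem desirableBy_image_compatiblePrevisions (K : Set (Finset (Gamble X))) :
    desirableBy '' compatiblePrevisions K = mixingArchimedeanAbove K := by
  refine Set.Subset.antisymm ?_ fun D hD => ⟨lowerPrevision D,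
    ⟨isLinearPrevision_lowerPrevision hD.1, fun A hA => ?_⟩, hD.1.2.desirableBy_lowerPrevision⟩
  · rintro _ ⟨P, hP, rfl⟩
    exact ⟨hP.1.desirableBy_mem_mixingArchimedean, hP.2⟩
  · have hmeets : A ∈ setsOf (desirableBy (lowerPrevision D)) := by
      rw [hD.1.2.desirableBy_lowerPrevision]
      exact hD.2 hA
    exact hmeets

theorem IsArchimedeanSets.mem_compatiblePrevisions_iff (hK : IsArchimedeanSets K) :
    P ∈ compatiblePrevisions K ↔ IsLinearPrevision P ∧ ∀ A ∈ K, ∃ u ∈ A, 0 ≤ P u := by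
  refine ⟨fun h => ⟨h.1, fun A hA => (h.2 A hA).imp fun u hu => ⟨hu.1, hu.2.le⟩⟩,
    fun ⟨hP, hnonneg⟩ => ⟨hP, fun A hA => ?_⟩⟩
  obtain ⟨ε, hε, hAε⟩ := hK.archimedean A hA
  obtain ⟨_, hv, hPv⟩ := hnonneg _ hAε
  obtain ⟨u, hu, rfl⟩ := mem_shift.1 hv
  rw [hP.map_sub, hP.map_const, sub_nonneg] at hPv
  exact ⟨u, hu, hε.trans_le hPv⟩

theorem IsArchimedeanSets.isClosed_compatiblePrevisions (hK : IsArchimedeanSets K) :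
    IsClosed (compatiblePrevisions K) := by
  have hinter : compatiblePrevisions K =
      {P | IsLinearPrevision P} ∩ ⋂ A ∈ K, ⋃ u ∈ A, {P | 0 ≤ P u} := by
    ext P
    simp [hK.mem_compatiblePrevisions_iff]
  rw [hinter]
  exact isClosed_setOf_isLinearPrevision.inter (isClosed_biInter fun A _ =>
    A.finite_toSet.isClosed_biUnion fun u _ => isClosed_le continuous_const (continuous_apply u))

theorem exists_mem_compatiblePrevisions_nonpos (hmix : IsMixingSets (strictlyPositive X) K)
    (harch : IsArchimedeanSets K) {A : Finset (Gamble X)} (hA : A ∉ K) :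
    ∃ P ∈ compatiblePrevisions K, ∀ u ∈ A, P u ≤ 0 := by
  obtain ⟨N, hAN, hN⟩ := (hmix.consistentWith_hull hA).exists_le_maximal
  have hneg : ∀ B ∈ K, ∃ b ∈ B, -b ∈ N := fun B => hmix.exists_neg_mem_of_maximal hN
  obtain ⟨P, hP, hPN⟩ := exists_isLinearPrevision_nonpos N
    (fun u hu => by simpa using hneg {u} (hmix.pos_mem u hu))
    fun u hu huN => hN.prop {u} (hmix.pos_mem u hu) (by simpa using huN)
  refine ⟨P, harch.mem_compatiblePrevisions_iff.2 ⟨hP, fun B hB => ?_⟩,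
    fun u hu => hPN u (hAN (PointedCone.subset_hull hu))⟩
  obtain ⟨b, hb, hbN⟩ := hneg B hB
  exact ⟨b, hb, by simpa [hP.map_neg] using hPN _ hbN⟩

theorem representsByPrevisions_compatiblePrevisions
    (hmix : IsMixingSets (strictlyPositive X) K) (harch : IsArchimedeanSets K) :
    RepresentsByPrevisions (compatiblePrevisions K) K where
  nonempty := by
    have hempty : ∅ ∉ K := fun h => hmix.zero_notMem (hmix.mono _ h _ (Finset.empty_subset _))
    exact (exists_mem_compatiblePrevisions_nonpos hmix harch hempty).imp fun _ h => h.1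
  isLinearPrevision _ hP := hP.1
  isClosed := harch.isClosed_compatiblePrevisions
  eq_desirableSetsBy := by
    ext A
    rw [mem_desirableSetsBy]
    refine ⟨fun hA P hP => hP.2 A hA, fun hA => ?_⟩
    by_contra hAK
    obtain ⟨P, hP, hPA⟩ := exists_mem_compatiblePrevisions_nonpos hmix harch hAK
    obtain ⟨u, hu, hPu⟩ := hA P hP
    exact (hPA u hu).not_gt hPu

theorem represents_mixingArchimedeanAbove (hmix : IsMixingSets (strictlyPositive X) K)
    (harch : IsArchimedeanSets K) : Represents (mixingArchimedeanAbove K) K :=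
  desirableBy_image_compatiblePrevisions K ▸
    (representsByPrevisions_compatiblePrevisions hmix harch).represents

end Representation

end Gambles

end Desirability

theorem mainTheorem5 {X : Type*} [Nonempty X]
    (K : Set (Finset (Desirability.Gamble X))) :
    -- representation by a non-empty closed family of mixing Archimedean sets of gambles
    ((Desirability.IsMixingSets (Desirability.strictlyPositive X) K ∧
        Desirability.IsArchimedeanSets K) ↔
      ∃ 𝒟 : Set (Set (Desirability.Gamble X)), Desirability.Represents 𝒟 K) ∧
    -- E-admissibility with respect to a non-empty closed set of linear previsions
    ((Desirability.IsMixingSets (Desirability.strictlyPositive X) K ∧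
        Desirability.IsArchimedeanSets K) ↔
      ∃ M : Set (Desirability.Gamble X → ℝ), M.Nonempty ∧
        (∀ P ∈ M, Desirability.IsLinearPrevision P) ∧ IsClosed M ∧
        Desirability.Connected K (Desirability.eRejected M)) ∧
    -- the largest representing family
    ((Desirability.IsMixingSets (Desirability.strictlyPositive X) K ∧
        Desirability.IsArchimedeanSets K) →
      IsGreatest {𝒟 : Set (Set (Desirability.Gamble X)) | Desirability.Represents 𝒟 K}
        (Desirability.mixingArchimedeanAbove K)) := by
  refine ⟨⟨fun h => ⟨_, Desirability.represents_mixingArchimedeanAbove h.1 h.2⟩, ?_⟩, ⟨?_, ?_⟩,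
    fun h => ⟨Desirability.represents_mixingArchimedeanAbove h.1 h.2,
      fun _ h𝒟 => h𝒟.subset_mixingArchimedeanAbove⟩⟩
  · rintro ⟨𝒟, h𝒟⟩
    have hM := h𝒟.representsByPrevisions
    exact ⟨hM.isMixingSets, hM.isArchimedeanSets⟩
  · rintro ⟨hmix, harch⟩
    have hM := Desirability.representsByPrevisions_compatiblePrevisions hmix harch
    exact ⟨_, hM.nonempty, hM.isLinearPrevision, hM.isClosed,
      (Desirability.connected_eRejected_iff fun P hP => (hM.isLinearPrevision P hP).map_sub).2
        hM.eq_desirableSetsBy⟩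
  · rintro ⟨M, hne, hlin, hclosed, hconn⟩
    have hM : Desirability.RepresentsByPrevisions M K := ⟨hne, hlin, hclosed,
      (Desirability.connected_eRejected_iff fun P hP => (hlin P hP).map_sub).1 hconn⟩
    exact ⟨hM.isMixingSets, hM.isArchimedeanSets⟩
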